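/- Theorem 2.1. Let $n,k$ be integers with $1\le k\le n-1$, and let $x_1,\dots,x_{k+1}\in\mathbb R^n$ be in general position, i.e. affinely independent. Write $\mathbf H\{y_1,\dots,y_m\}$ for the smallest affine subspace (plane) of $\mathbb R^n$ containing $y_1,\dots,y_m$, and put $$\mathbf H_{x_0}=\{x\in\mathbb R^n:\langle x-x_0,x_0\rangle=0\},\qquad \mathbf U=\{x\in\mathbb R^n:\langle x-x_1,x\rangle=\dots=\langle x-x_{k+1},x\rangle=0\}.$$ Call $x_0\in\mathbb R^n$ admissible if $x_0\notin\mathbf H\{x_1,\dots,x_{k+1}\}\cup\mathbf U$, and for admissible $x_0$ let $$\Sigma_{x_0}=\mathbf H\{x_0,x_1,\dots,x_{k+1}\}\cap\mathbf H_{x_0}.$$ Then every such $\Sigma_{x_0}$ is a $k$-dimensional plane through $x_0$. Let $f:\mathbb R^n\to\mathbb R$ be a $C^\infty$ function such that, for some real $N>k+1$, $f(x)=o(|x|^{-N})$ as $|x|\to\infty$. Then $f$ is integrable over every $\Sigma_{x_0}$ with respect to the $k$-dimensional area measure $dm_{\Sigma_{x_0}}$, and $f$ is uniquely determined by the integrals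 $$(\mathcal R_kf)(\Sigma_{x_0})=\int_{\Sigma_{x_0}}f\,dm_{\Sigma_{x_0}},\qquad x_0\ \text{admissible}.$$ That is, if $f$ and $g$ are two $C^\infty$ functions satisfying this decay condition (each with some exponent greater than $k+1$) and $(\mathcal R_kf)(\Sigma_{x_0})=(\mathcal R_kg)(\Sigma_{x_0})$ for all admissible $x_0$, then $f=g$. -/

import Mathlib

open MeasureTheory Filter Asymptotics
open scoped ContDiff

namespace KPlaneRadon

noncomputable section

/-- The `k`-dimensional Radon transform of `f` at the `k`-plane `S`: the integral of `f` over `S`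
with respect to the area measure of `S`, that is, the `k`-dimensional Hausdorff measure
(normalized so as to agree with Lebesgue measure on `ℝᵏ`) restricted to `S`. -/
def radonTransform {n : ℕ} (k : ℕ) (f : EuclideanSpace ℝ (Fin n) → ℝ)
    (S : AffineSubspace ℝ (EuclideanSpace ℝ (Fin n))) : ℝ :=
  ∫ y in (S : Set (EuclideanSpace ℝ (Fin n))), f y ∂μHE[k]

/-- The hyperplane `{y : ⟪y - p, p⟫ = 0}` through `p` and normal to `p` (used for `p ≠ 0`). -/
def normalHyperplane {n : ℕ} (p : EuclideanSpace ℝ (Fin n)) :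
    AffineSubspace ℝ (EuclideanSpace ℝ (Fin n)) :=
  AffineSubspace.mk' p (ℝ ∙ p)ᗮ

theorem mem_normalHyperplane {n : ℕ} (p y : EuclideanSpace ℝ (Fin n)) :
    y ∈ normalHyperplane p ↔ inner ℝ (y - p) p = 0 := by
  rw [normalHyperplane, AffineSubspace.mem_mk', vsub_eq_sub,
    Submodule.mem_orthogonal_singleton_iff_inner_left]

/-- The set `U{x₁, …, xₘ}` of all `p` with `⟪p - x₁, p⟫ = ⋯ = ⟪p - xₘ, p⟫ = 0`. -/
def exceptionalSet {n : ℕ} {ι : Type*} (x : ι → EuclideanSpace ℝ (Fin n)) :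
    Set (EuclideanSpace ℝ (Fin n)) :=
  {p | ∀ i, inner ℝ (p - x i) p = 0}

/-- The admissible points: those lying neither in the plane spanned by the points `x i` nor in
the exceptional set. -/
def admissible {n : ℕ} {ι : Type*} (x : ι → EuclideanSpace ℝ (Fin n)) :
    Set (EuclideanSpace ℝ (Fin n)) :=
  ((affineSpan ℝ (Set.range x) : Set (EuclideanSpace ℝ (Fin n))) ∪ exceptionalSet x)ᶜ

/-- The plane `Σ_p`: the intersection of the plane through `p` and all the `x i` with the
hyperplane through `p` normal to `p`. -/
def sigmaPlane {n : ℕ} {ι : Type*} (x : ι → EuclideanSpace ℝ (Fin n))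
    (p : EuclideanSpace ℝ (Fin n)) : AffineSubspace ℝ (EuclideanSpace ℝ (Fin n)) :=
  affineSpan ℝ (insert p (Set.range x)) ⊓ normalHyperplane p

/-- The family of all planes `Σ_p` with `p` admissible. -/
def planeFamily {n : ℕ} {ι : Type*} (x : ι → EuclideanSpace ℝ (Fin n)) :
    Set (AffineSubspace ℝ (EuclideanSpace ℝ (Fin n))) :=
  sigmaPlane x '' admissible x

/-- The `C^∞` functions `f` on `ℝⁿ` with `f(y) = o(|y|^{-N})` as `|y| → ∞`, for some real
`N > k + 1` (which may depend on `f`). -/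
def decayClass (n k : ℕ) : Set (EuclideanSpace ℝ (Fin n) → ℝ) :=
  {f | ContDiff ℝ ∞ f ∧
    ∃ N : ℝ, (k : ℝ) + 1 < N ∧
      f =o[cocompact (EuclideanSpace ℝ (Fin n))] fun y => ‖y‖ ^ (-N)}

end

end KPlaneRadon

/-! Fix a `(k+1)`-plane `D` through all `x i`; any `p ∈ D` off their span spans `D` together with
them. Let `v` be the foot of the perpendicular from the origin to `D`. For `p = v + a` with `a` in
the direction of `D`, the component `v` of `p` is orthogonal to that direction, so `⟪y - p, p⟫ = ⟪y
- p, a⟫` on `D`: `Σ_p` is the hyperplane of `D` through `p` normal to `a` (`range_eq_sigmaPlane`).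
Almost all hyperplanes of `D` arise this way from admissible points (`ae_admissible`).

The problem thus becomes the classical hyperplane Radon transform on `D`. The exponent `N > k + 1`
makes `f - g` integrable there, and Fourier slicing with inversion forces it to vanish
(`eq_zero_of_integral_hyperplane_eq_zero`). The planes `D` cover the whole space. -/

namespace KPlaneRadon

open Module
open scoped FourierTransform RealInnerProductSpace

/-! ### Area measure on isometric images of Euclidean spaces -/

section Isometry

variable {V X F : Type*} [NormedAddCommGroup V] [InnerProductSpace ℝ V] [FiniteDimensional ℝ V]
  [MeasurableSpace V] [BorelSpace V] [MetricSpace X] [MeasurableSpace X] [BorelSpace X]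
  [NormedAddCommGroup F]

theorem map_volume_of_isometry {k : ℕ} (hk : finrank ℝ V = k) {φ : V → X} (hφ : Isometry φ) :
    (volume : Measure V).map φ = (μHE[k] : Measure X).restrict (Set.range φ) := by
  rw [← InnerProductSpace.euclideanHausdorffMeasure_eq_volume, hk,
    hφ.map_euclideanHausdorffMeasure]

theorem setIntegral_range_of_isometry [NormedSpace ℝ F] {k : ℕ} (hk : finrank ℝ V = k)
    {φ : V → X} (hφ : Isometry φ) (f : X → F) :
    ∫ y in Set.range φ, f y ∂μHE[k] = ∫ z, f (φ z) := by
  rw [← map_volume_of_isometry hk hφ]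
  exact hφ.isClosedEmbedding.measurableEmbedding.integral_map f

theorem integrableOn_range_of_isometry {k : ℕ} (hk : finrank ℝ V = k)
    {φ : V → X} (hφ : Isometry φ) (f : X → F) :
    IntegrableOn f (Set.range φ) μHE[k] ↔ Integrable (fun z => f (φ z)) := by
  rw [IntegrableOn, ← map_volume_of_isometry hk hφ]
  exact hφ.isClosedEmbedding.measurableEmbedding.integrable_map_iff

end Isometry

/-- A continuous function which is `O(|y|^{-N})` at infinity is integrable along every isometrically
embedded Euclidean space of dimension less than `N`. -/
theorem integrable_comp_isometry_of_isBigO {V E : Type*} [NormedAddCommGroup V]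
    [InnerProductSpace ℝ V] [FiniteDimensional ℝ V] [MeasurableSpace V] [BorelSpace V]
    [NormedAddCommGroup E] {f : E → ℝ} (hf : Continuous f) {N : ℝ}
    (hN : (finrank ℝ V : ℝ) < N) (hfN : f =O[cocompact E] fun y => ‖y‖ ^ (-N))
    {φ : V → E} (hφ : Isometry φ) : Integrable (fun z => f (φ z)) := by
  refine (hf.comp hφ.continuous).locallyIntegrable.integrable_of_isBigO_cocompact
    (g := fun z => (1 + ‖z‖) ^ (-N)) ?_ ⟨Set.univ, univ_mem, ?_⟩
  · refine (hfN.comp_tendsto hφ.isClosedEmbedding.tendsto_cocompact).trans ?_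
    have hN0 : 0 ≤ N := (Nat.cast_nonneg _).trans hN.le
    -- For `‖z‖ ≥ 2‖φ 0‖ + 1`, `‖φ z‖ ≥ ‖z‖ - ‖φ 0‖ ≥ (1 + ‖z‖) / 2`; the factor `1/2` becomes `2 ^
    -- N`.
    refine IsBigO.of_bound (2 ^ N) ?_
    filter_upwards [(tendsto_norm_cocompact_atTop (E := V)).eventually_ge_atTop
      (2 * ‖φ 0‖ + 1)] with z hz
    have h1 : ‖z‖ ≤ ‖φ z‖ + ‖φ 0‖ := by
      have := hφ.dist_eq z 0
      rw [dist_zero_right, dist_eq_norm] at this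
      rw [← this]
      exact norm_sub_le _ _
    have h2 : (1 + ‖z‖) / 2 ≤ ‖φ z‖ := by linarith
    have h3 : 0 < 1 + ‖z‖ := by positivity
    rw [Function.comp_apply, Real.norm_of_nonneg (by positivity),
      Real.norm_of_nonneg (by positivity)]
    calc ‖φ z‖ ^ (-N) ≤ ((1 + ‖z‖) / 2) ^ (-N) :=
          Real.rpow_le_rpow_of_nonpos (by positivity) h2 (by linarith)
      _ = 2 ^ N * (1 + ‖z‖) ^ (-N) := by
          rw [Real.div_rpow h3.le (by norm_num), Real.rpow_neg zero_le_two, div_inv_eq_mul,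
            mul_comm]
  · rw [integrableOn_univ]
    exact integrable_one_add_norm hN

/-! ### Fourier slices and injectivity for hyperplane integrals -/

section Fourier

variable {W : Type*} [NormedAddCommGroup W] [InnerProductSpace ℝ W] [FiniteDimensional ℝ W]
  [MeasurableSpace W] [BorelSpace W]

/-- The Fourier transform of `G` vanishes at `ξ` if the integrals of `G` over almost all
hyperplanes normal to `ξ` vanish. -/
theorem fourier_eq_zero_of_integral_hyperplane_eq_zero {G : W → ℂ} (hG : Integrable G) {ξ : W}
    (h : ∀ᵐ a : (ℝ ∙ ξ : Submodule ℝ W), ∫ z : ((ℝ ∙ ξ)ᗮ : Submodule ℝ W), G (a + z) = 0) :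
    𝓕 G ξ = 0 := by
  let e := (ℝ ∙ ξ : Submodule ℝ W).measurableEquivProd (0 : W)
  have he : MeasurePreserving e.symm (volume.prod volume) volume := by
    have := ((ℝ ∙ ξ : Submodule ℝ W).measurePreserving_measurableEquivProd (0 : W)).symm
    rwa [InnerProductSpace.euclideanHausdorffMeasure_eq_volume] at this
  have hint : Integrable (fun w => 𝐞 (-⟪w, ξ⟫) • G w) :=
    (Real.fourierIntegral_convergent_iff ξ).2 hG
  have hprod : Integrable (fun q => 𝐞 (-⟪e.symm q, ξ⟫) • G (e.symm q)) (volume.prod volume) :=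
    (he.integrable_comp_emb e.symm.measurableEmbedding).2 hint
  rw [Real.fourier_eq, ← he.integral_comp e.symm.measurableEmbedding, integral_prod _ hprod]
  refine integral_eq_zero_of_ae ?_
  filter_upwards [h] with a ha
  -- The character is constant on each slice normal to `ξ`, so it leaves the inner integral.
  have hz (z : ((ℝ ∙ ξ)ᗮ : Submodule ℝ W)) : ⟪(a : W) + z, ξ⟫ = ⟪(a : W), ξ⟫ := by
    rw [inner_add_left, Submodule.mem_orthogonal_singleton_iff_inner_left.1 z.2, add_zero]
  simp only [e, Submodule.measurableEquivProd_symm_apply, vadd_eq_add, add_zero, hz,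
    Pi.zero_apply, Circle.smul_def]
  rw [integral_smul, ha, smul_zero]

/-- A continuous integrable function with vanishing integrals over almost all hyperplanes is
zero. -/
theorem eq_zero_of_integral_hyperplane_eq_zero {G : W → ℂ} (hc : Continuous G)
    (hG : Integrable G)
    (h : ∀ᵐ ξ : W, ∀ᵐ a : (ℝ ∙ ξ : Submodule ℝ W),
      ∫ z : ((ℝ ∙ ξ)ᗮ : Submodule ℝ W), G (a + z) = 0) : G = 0 := by
  have h0 : 𝓕 G =ᵐ[volume] 0 := by
    filter_upwards [h] with ξ hξ using fourier_eq_zero_of_integral_hyperplane_eq_zero hG hξ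
  -- Inversion needs `𝓕 G` integrable, which holds because it is a.e. zero.
  rw [← hc.fourierInv_fourier_eq hG ((integrable_zero _ _ _).congr h0.symm)]
  ext w
  rw [Real.fourierInv_eq]
  refine integral_eq_zero_of_ae ?_
  filter_upwards [h0] with v hv
  simp [hv]

end Fourier

/-! ### Consequences of the decay condition -/

section Decay

variable {n k : ℕ} {V : Type*} [NormedAddCommGroup V] [InnerProductSpace ℝ V]
  [FiniteDimensional ℝ V] [MeasurableSpace V] [BorelSpace V]
  {f g : EuclideanSpace ℝ (Fin n) → ℝ}

/-- Dimension `k + 1` is allowed, not only `k`, since the Fourier argument runs on `(k+1)`-planes.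
-/
theorem integrable_comp_isometry (hf : f ∈ decayClass n k) (hV : finrank ℝ V ≤ k + 1)
    {φ : V → EuclideanSpace ℝ (Fin n)} (hφ : Isometry φ) : Integrable (fun z => f (φ z)) := by
  obtain ⟨hsmooth, N, hN, hfN⟩ := hf
  refine integrable_comp_isometry_of_isBigO hsmooth.continuous (lt_of_le_of_lt ?_ hN)
    hfN.isBigO hφ
  exact_mod_cast hV

theorem integral_sub_comp_eq_zero (hf : f ∈ decayClass n k) (hg : g ∈ decayClass n k)
    (hV : finrank ℝ V = k) {φ : V → EuclideanSpace ℝ (Fin n)} (hφ : Isometry φ)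
    {S : AffineSubspace ℝ (EuclideanSpace ℝ (Fin n))} (hS : Set.range φ = S)
    (hfg : radonTransform k f S = radonTransform k g S) :
    ∫ z, ((f (φ z) - g (φ z) : ℝ) : ℂ) = 0 := by
  rw [radonTransform, radonTransform, ← hS, setIntegral_range_of_isometry hV hφ,
    setIntegral_range_of_isometry hV hφ] at hfg
  rw [integral_complex_ofReal, integral_sub (integrable_comp_isometry hf (by omega) hφ)
    (integrable_comp_isometry hg (by omega) hφ), hfg, sub_self, Complex.ofReal_zero]

end Decay

/-! ### Dimensions of the planes -/

section Geometry

variable {n k : ℕ} {x : Fin (k + 1) → EuclideanSpace ℝ (Fin n)}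

theorem finrank_direction_affineSpan_insert (hx : AffineIndependent ℝ x)
    {p : EuclideanSpace ℝ (Fin n)} (hp : p ∉ affineSpan ℝ (Set.range x)) :
    finrank ℝ (affineSpan ℝ (insert p (Set.range x))).direction = k + 1 := by
  have h0 : x 0 ∈ affineSpan ℝ (Set.range x) := mem_affineSpan ℝ (Set.mem_range_self 0)
  rw [← affineSpan_insert_affineSpan, AffineSubspace.direction_affineSpan_insert h0, sup_comm,
    Submodule.finrank_sup_span_singleton, direction_affineSpan,
    hx.finrank_vectorSpan (Fintype.card_fin _)]
  rwa [AffineSubspace.vsub_right_mem_direction_iff_mem h0]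

theorem affineSpan_insert_eq_of_mem (hx : AffineIndependent ℝ x)
    {p u : EuclideanSpace ℝ (Fin n)} (hu : u ∉ affineSpan ℝ (Set.range x))
    (hp : p ∉ affineSpan ℝ (Set.range x)) (hpu : p ∈ affineSpan ℝ (insert u (Set.range x))) :
    affineSpan ℝ (insert p (Set.range x)) = affineSpan ℝ (insert u (Set.range x)) := by
  have hle : affineSpan ℝ (insert p (Set.range x)) ≤ affineSpan ℝ (insert u (Set.range x)) :=
    affineSpan_le.2 (Set.insert_subset hpu
      ((Set.subset_insert _ _).trans (subset_affineSpan ℝ _)))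
  refine AffineSubspace.eq_of_direction_eq_of_nonempty_of_le ?_
    ⟨p, mem_affineSpan ℝ (Set.mem_insert _ _)⟩ hle
  refine Submodule.eq_of_le_of_finrank_eq (AffineSubspace.direction_le hle) ?_
  rw [finrank_direction_affineSpan_insert hx hp, finrank_direction_affineSpan_insert hx hu]

theorem mem_sigmaPlane_self (p : EuclideanSpace ℝ (Fin n)) : p ∈ sigmaPlane x p :=
  ⟨mem_affineSpan ℝ (Set.mem_insert _ _), by simp [mem_normalHyperplane]⟩

theorem mem_sigmaPlane {p y : EuclideanSpace ℝ (Fin n)} :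
    y ∈ sigmaPlane x p ↔ y ∈ affineSpan ℝ (insert p (Set.range x)) ∧ ⟪y - p, p⟫ = 0 := by
  rw [sigmaPlane, AffineSubspace.mem_inf_iff, mem_normalHyperplane]

/-- The projection `a` of `p` to the direction of the spanned `(k+1)`-plane is nonzero, since `a =
0` would put `p` in the exceptional set. Hence the direction of `Σ_p` is the complement of a line in
a space of dimension `k + 1`. -/
theorem finrank_direction_sigmaPlane (hx : AffineIndependent ℝ x)
    {p : EuclideanSpace ℝ (Fin n)} (hp : p ∈ admissible x) :
    finrank ℝ (sigmaPlane x p).direction = k := by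
  obtain ⟨hpA, hpU⟩ : p ∉ affineSpan ℝ (Set.range x) ∧ p ∉ exceptionalSet x := by
    simpa [admissible] using hp
  have hW := finrank_direction_affineSpan_insert hx hpA
  have hpD : p ∈ affineSpan ℝ (insert p (Set.range x)) := mem_affineSpan ℝ (Set.mem_insert _ _)
  have hpH : p ∈ normalHyperplane p := by simp [mem_normalHyperplane]
  rw [sigmaPlane, AffineSubspace.direction_inf_of_mem hpD hpH, normalHyperplane,
    AffineSubspace.direction_mk']
  set D := affineSpan ℝ (insert p (Set.range x))
  set a := D.direction.starProjection p
  have hinner {w} (hw : w ∈ D.direction) : ⟪w, p⟫ = ⟪w, a⟫ := by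
    rw [← sub_eq_zero, ← inner_sub_right, real_inner_comm]
    exact D.direction.starProjection_inner_eq_zero p w hw
  have ha0 : a ≠ 0 := by
    intro h
    refine hpU fun i => ?_
    have hxi : x i ∈ D := mem_affineSpan ℝ (Set.mem_insert_of_mem _ (Set.mem_range_self i))
    have := hinner (AffineSubspace.vsub_mem_direction hpD hxi)
    rwa [h, inner_zero_right] at this
  have heq : D.direction ⊓ (ℝ ∙ p)ᗮ = (ℝ ∙ a)ᗮ ⊓ D.direction := by
    ext w
    simp only [Submodule.mem_inf, Submodule.mem_orthogonal_singleton_iff_inner_left]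
    constructor
    · rintro ⟨h1, h2⟩
      exact ⟨by rwa [← hinner h1], h1⟩
    · rintro ⟨h1, h2⟩
      exact ⟨h2, by rwa [hinner h2]⟩
  have := Submodule.finrank_add_inf_finrank_orthogonal (K₁ := ℝ ∙ a) (K₂ := D.direction)
    ((Submodule.span_singleton_le_iff_mem _ _).2 (D.direction.starProjection_apply_mem p))
  rw [finrank_span_singleton ha0, hW] at this
  rw [heq]
  omega

end Geometry

theorem integrableOn_sigmaPlane {n k : ℕ} {x : Fin (k + 1) → EuclideanSpace ℝ (Fin n)}
    (hx : AffineIndependent ℝ x) {f : EuclideanSpace ℝ (Fin n) → ℝ} (hf : f ∈ decayClass n k)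
    {p : EuclideanSpace ℝ (Fin n)} (hp : p ∈ admissible x) :
    IntegrableOn f (sigmaPlane x p : Set (EuclideanSpace ℝ (Fin n))) μHE[k] := by
  have hdim := finrank_direction_sigmaPlane hx hp
  let φ : (sigmaPlane x p).direction → EuclideanSpace ℝ (Fin n) := fun z => p + z
  have hφ : Isometry φ := (isometry_add_left p).comp isometry_subtype_coe
  have hrange : Set.range φ = sigmaPlane x p := by
    ext y
    constructor
    · rintro ⟨z, rfl⟩
      simpa [φ, add_comm] using
        AffineSubspace.vadd_mem_of_mem_direction z.2 (mem_sigmaPlane_self (x := x) p)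
    · intro hy
      exact ⟨⟨y - p, AffineSubspace.vsub_mem_direction hy (mem_sigmaPlane_self p)⟩, by simp [φ]⟩
  rw [← hrange, integrableOn_range_of_isometry hdim hφ]
  exact integrable_comp_isometry hf (by omega) hφ

/-! ### Reduction to hyperplanes of a `(k+1)`-plane -/

section Uniqueness

variable {n k : ℕ} {x : Fin (k + 1) → EuclideanSpace ℝ (Fin n)}

/-- Along a line `v + ℝξ` which is orthogonal to its base point `v` and not parallel to the plane
spanned by the `x i`, almost every point is admissible. -/
theorem ae_admissible {D : AffineSubspace ℝ (EuclideanSpace ℝ (Fin n))} (hxD : ∀ i, x i ∈ D)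
    {v : EuclideanSpace ℝ (Fin n)} (hvD : v ∈ D) (hv : ∀ w ∈ D.direction, ⟪w, v⟫ = 0)
    {ξ : D.direction} (hξ : (ξ : EuclideanSpace ℝ (Fin n)) ∉ (affineSpan ℝ (Set.range x)).direction) :
    ∀ᵐ a : (ℝ ∙ ξ : Submodule ℝ D.direction), v + ((a : D.direction) : EuclideanSpace ℝ (Fin n)) ∈
      admissible x := by
  have hξ0 : ξ ≠ 0 := by
    rintro rfl
    exact hξ (Submodule.zero_mem _)
  have hξξ : ⟪(ξ : EuclideanSpace ℝ (Fin n)), ξ⟫ ≠ 0 := by simpa using hξ0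
  let S : Set (ℝ ∙ ξ : Submodule ℝ D.direction) :=
    {a | v + ((a : D.direction) : EuclideanSpace ℝ (Fin n)) ∈ affineSpan ℝ (Set.range x)}
  let T : Set (ℝ ∙ ξ : Submodule ℝ D.direction) :=
    {a | a ≠ 0 ∧ v + ((a : D.direction) : EuclideanSpace ℝ (Fin n)) ∈ exceptionalSet x}
  have hS : S.Subsingleton := by
    rintro ⟨a, ha⟩ haS ⟨b, hb⟩ hbS
    obtain ⟨s, rfl⟩ := Submodule.mem_span_singleton.1 ha
    obtain ⟨t, rfl⟩ := Submodule.mem_span_singleton.1 hb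
    have h := AffineSubspace.vsub_mem_direction (s := affineSpan ℝ (Set.range x)) haS hbS
    simp only [vsub_eq_sub, add_sub_add_left_eq_sub, Submodule.coe_smul, ← sub_smul] at h
    have hst : s - t = 0 := by
      by_contra hne
      exact hξ ((Submodule.smul_mem_iff _ hne).1 h)
    simp [sub_eq_zero.1 hst]
  -- With `v` orthogonal to `D`, the condition reads `s² ⟪ξ, ξ⟫ = s ⟪x 0 - v, ξ⟫`. The root `s = 0`
  -- is the point `v`, which is always exceptional; at most one other remains.
  have key {s : ℝ} (h0 : s ≠ 0) (h : v + s • (ξ : EuclideanSpace ℝ (Fin n)) ∈ exceptionalSet x) :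
      s = ⟪x 0 - v, (ξ : EuclideanSpace ℝ (Fin n))⟫ / ⟪(ξ : EuclideanSpace ℝ (Fin n)), ξ⟫ := by
    have h1 : ⟪v + s • (ξ : EuclideanSpace ℝ (Fin n)) - x 0,
      v + s • (ξ : EuclideanSpace ℝ (Fin n))⟫ = 0 := h 0
    have h2 : ⟪x 0 - v, v⟫ = 0 := hv _ (AffineSubspace.vsub_mem_direction (hxD 0) hvD)
    have h3 : ⟪(ξ : EuclideanSpace ℝ (Fin n)), v⟫ = 0 := hv _ ξ.2
    have h4 : v + s • (ξ : EuclideanSpace ℝ (Fin n)) - x 0 =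
      s • (ξ : EuclideanSpace ℝ (Fin n)) - (x 0 - v) := by abel
    rw [h4, inner_add_right, inner_sub_left, h2, inner_smul_left, h3, inner_smul_right,
      inner_sub_left, inner_smul_left] at h1
    rw [eq_div_iff hξξ]
    refine mul_left_cancel₀ h0 ?_
    simp only [conj_trivial] at h1
    linarith
  have hT : T.Subsingleton := by
    rintro ⟨a, ha⟩ ⟨ha0, haT⟩ ⟨b, hb⟩ ⟨hb0, hbT⟩
    obtain ⟨s, rfl⟩ := Submodule.mem_span_singleton.1 ha
    obtain ⟨t, rfl⟩ := Submodule.mem_span_singleton.1 hb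
    have hs := key (s := s) (by rintro rfl; simp at ha0) haT
    have ht := key (s := t) (by rintro rfl; simp at hb0) hbT
    simp [hs, ht]
  -- Nontriviality makes the volume on the line atomless, so finite sets are null.
  have : Nontrivial (ℝ ∙ ξ : Submodule ℝ D.direction) :=
    Submodule.nontrivial_span_singleton hξ0
  have hfin : (S ∪ (T ∪ {0})).Finite :=
    hS.finite.union (hT.finite.union (Set.finite_singleton _))
  filter_upwards [compl_mem_ae_iff.2 (hfin.measure_zero volume)] with a ha
  simp only [Set.mem_compl_iff, Set.mem_union, not_or] at ha
  rintro (h | h)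
  · exact ha.1 h
  · exact ha.2.1 ⟨ha.2.2, h⟩

/-- For `p = v + a` admissible, with `v` the foot of the perpendicular from the origin to `D` and
`a ∈ ℝξ`, the plane `Σ_p` is the hyperplane of `D` through `p` normal to `ξ`. -/
theorem range_eq_sigmaPlane {D : AffineSubspace ℝ (EuclideanSpace ℝ (Fin n))}
    (hD : ∀ p ∉ affineSpan ℝ (Set.range x), p ∈ D → affineSpan ℝ (insert p (Set.range x)) = D)
    (hxD : ∀ i, x i ∈ D) {v : EuclideanSpace ℝ (Fin n)} (hvD : v ∈ D)
    (hv : ∀ w ∈ D.direction, ⟪w, v⟫ = 0)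
    {ξ : D.direction} {a : (ℝ ∙ ξ : Submodule ℝ D.direction)}
    (ha : v + ((a : D.direction) : EuclideanSpace ℝ (Fin n)) ∈ admissible x) :
    Set.range (fun z : ((ℝ ∙ ξ)ᗮ : Submodule ℝ D.direction) =>
      v + ((a + z : D.direction) : EuclideanSpace ℝ (Fin n))) =
    sigmaPlane x (v + ((a : D.direction) : EuclideanSpace ℝ (Fin n))) := by
  obtain ⟨a, haξ⟩ := a
  obtain ⟨s, rfl⟩ := Submodule.mem_span_singleton.1 haξ
  simp only at ha ⊢
  have hs : s ≠ 0 := by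
    rintro rfl
    refine ha (Or.inr fun i => ?_)
    simpa using hv _ (AffineSubspace.vsub_mem_direction hvD (hxD i))
  have hpD : v + ((s • ξ : D.direction) : EuclideanSpace ℝ (Fin n)) ∈ D := by
    simpa [add_comm] using AffineSubspace.vadd_mem_of_mem_direction (s • ξ).2 hvD
  have hinner (z : D.direction) : ⟪(z : EuclideanSpace ℝ (Fin n)),
      v + ((s • ξ : D.direction) : EuclideanSpace ℝ (Fin n))⟫ = s * ⟪z, ξ⟫ := by
    rw [inner_add_right, hv _ z.2, zero_add, Submodule.coe_smul, inner_smul_right,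
      Submodule.coe_inner]
  ext y
  rw [SetLike.mem_coe, mem_sigmaPlane, hD _ (fun h => ha (Or.inl h)) hpD]
  constructor
  · rintro ⟨z, rfl⟩
    refine ⟨?_, ?_⟩
    · simpa [add_comm] using
        AffineSubspace.vadd_mem_of_mem_direction (s • ξ + (z : D.direction)).2 hvD
    · have h : v + ((s • ξ + z : D.direction) : EuclideanSpace ℝ (Fin n)) -
          (v + ((s • ξ : D.direction) : EuclideanSpace ℝ (Fin n))) = (z : D.direction) := by
        rw [Submodule.coe_add]
        abel
      rw [h, hinner, Submodule.mem_orthogonal_singleton_iff_inner_left.1 z.2, mul_zero]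
  · rintro ⟨hyD, hy⟩
    let z : D.direction := ⟨_, AffineSubspace.vsub_mem_direction hyD hpD⟩
    have hz : z ∈ (ℝ ∙ ξ)ᗮ := by
      rw [Submodule.mem_orthogonal_singleton_iff_inner_left]
      exact (mul_eq_zero.1 ((hinner z).symm.trans hy)).resolve_left hs
    refine ⟨⟨z, hz⟩, ?_⟩
    simp only [Submodule.coe_add, z, vsub_eq_sub]
    abel

/-- The Radon transform over the planes `Σ_p` determines a function on every plane spanned by the
`x i` and one further point. -/
theorem eqOn_affineSpan_insert (hx : AffineIndependent ℝ x)
    {f g : EuclideanSpace ℝ (Fin n) → ℝ} (hf : f ∈ decayClass n k) (hg : g ∈ decayClass n k)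
    (hfg : ∀ S ∈ planeFamily x, radonTransform k f S = radonTransform k g S)
    {u : EuclideanSpace ℝ (Fin n)} (hu : u ∉ affineSpan ℝ (Set.range x)) :
    Set.EqOn f g (affineSpan ℝ (insert u (Set.range x))) := by
  have hW := finrank_direction_affineSpan_insert hx hu
  have hDeq := fun p => affineSpan_insert_eq_of_mem hx (p := p) hu
  have huD : u ∈ affineSpan ℝ (insert u (Set.range x)) := mem_affineSpan ℝ (Set.mem_insert _ _)
  have hxD : ∀ i, x i ∈ affineSpan ℝ (insert u (Set.range x)) := fun i =>
    mem_affineSpan ℝ (Set.mem_insert_of_mem _ (Set.mem_range_self i))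
  generalize affineSpan ℝ (insert u (Set.range x)) = D at hW hDeq huD hxD ⊢
  obtain ⟨v, hvD, hv⟩ : ∃ v ∈ D, ∀ w ∈ D.direction, ⟪w, v⟫ = 0 := by
    refine ⟨u - D.direction.starProjection u, ?_, fun w hw => ?_⟩
    · rw [← AffineSubspace.vsub_right_mem_direction_iff_mem huD]
      simp
    · rw [real_inner_comm]
      exact D.direction.starProjection_inner_eq_zero u w hw
  have hiso : Isometry fun w : D.direction => v + (w : EuclideanSpace ℝ (Fin n)) :=
    (isometry_add_left v).comp isometry_subtype_coe
  let G : D.direction → ℂ := fun w => ((f (v + w) - g (v + w) : ℝ) : ℂ)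
  have hGc : Continuous G := Complex.continuous_ofReal.comp
    ((hf.1.continuous.comp hiso.continuous).sub (hg.1.continuous.comp hiso.continuous))
  have hGi : Integrable G := Integrable.ofReal
    ((integrable_comp_isometry hf hW.le hiso).sub (integrable_comp_isometry hg hW.le hiso))
  have hG : G = 0 := by
    refine eq_zero_of_integral_hyperplane_eq_zero hGc hGi ?_
    -- The span of the `x i` has dimension `k < k + 1`, so the bad directions `ξ` form a proper,
    -- hence null, subspace.
    have hproper : (affineSpan ℝ (Set.range x)).direction.comap D.direction.subtype ≠ ⊤ := by
      intro h
      have hle : D.direction ≤ (affineSpan ℝ (Set.range x)).direction := fun w hw => by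
        have : (⟨w, hw⟩ : D.direction) ∈
          (affineSpan ℝ (Set.range x)).direction.comap D.direction.subtype := h ▸ trivial
        exact this
      have := Submodule.finrank_mono hle
      rw [hW, direction_affineSpan, hx.finrank_vectorSpan (Fintype.card_fin _)] at this
      omega
    filter_upwards [compl_mem_ae_iff.2 (Measure.addHaar_submodule volume _ hproper)] with ξ hξ
    filter_upwards [ae_admissible hxD hvD hv (ξ := ξ) hξ] with a hadm
    have hξ0 : ξ ≠ 0 := by
      rintro rfl
      exact hξ (Submodule.zero_mem _)
    let φ : ((ℝ ∙ ξ)ᗮ : Submodule ℝ D.direction) → EuclideanSpace ℝ (Fin n) :=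
      fun z => v + ((a + z : D.direction) : EuclideanSpace ℝ (Fin n))
    have hφ : Isometry φ := hiso.comp ((isometry_add_left (a : D.direction)).comp
      isometry_subtype_coe)
    have hdim : finrank ℝ ((ℝ ∙ ξ)ᗮ : Submodule ℝ D.direction) = k :=
      Submodule.finrank_add_finrank_orthogonal' (by rw [finrank_span_singleton hξ0, hW, add_comm])
    have hrange : Set.range φ =
        sigmaPlane x (v + ((a : D.direction) : EuclideanSpace ℝ (Fin n))) :=
      range_eq_sigmaPlane hDeq hxD hvD hv hadm
    exact integral_sub_comp_eq_zero hf hg hdim hφ hrange (hfg _ ⟨_, hadm, rfl⟩)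
  intro y hy
  have := congrFun hG ⟨y - v, AffineSubspace.vsub_mem_direction hy hvD⟩
  simpa [G, sub_eq_zero, ← Complex.ofReal_sub] using this

end Uniqueness

theorem eq_of_radonTransform_eq {n k : ℕ} (hkn : k + 1 ≤ n)
    {x : Fin (k + 1) → EuclideanSpace ℝ (Fin n)} (hx : AffineIndependent ℝ x)
    {f g : EuclideanSpace ℝ (Fin n) → ℝ} (hf : f ∈ decayClass n k) (hg : g ∈ decayClass n k)
    (hfg : ∀ S ∈ planeFamily x, radonTransform k f S = radonTransform k g S) : f = g := by
  have hdir : finrank ℝ (affineSpan ℝ (Set.range x)).direction = k := by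
    rw [direction_affineSpan, hx.finrank_vectorSpan (Fintype.card_fin _)]
  obtain ⟨u, hu⟩ : ∃ u, u ∉ affineSpan ℝ (Set.range x) := by
    by_contra! h
    rw [(SetLike.ext fun u => ⟨fun _ => trivial, fun _ => h u⟩ : affineSpan ℝ (Set.range x) = ⊤),
      AffineSubspace.direction_top, finrank_top, finrank_euclideanSpace_fin] at hdir
    omega
  ext y
  -- A point of the span lies in every `D`, and the point `u` supplies one; any other point spans
  -- its own `D`.
  by_cases hy : y ∈ affineSpan ℝ (Set.range x)
  · exact eqOn_affineSpan_insert hx hf hg hfg hu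
      (affineSpan_mono ℝ (Set.subset_insert u _) hy)
  · exact eqOn_affineSpan_insert hx hf hg hfg hy (mem_affineSpan ℝ (Set.mem_insert y _))

end KPlaneRadon

theorem theorem2p1 (n k : ℕ) (hk : 1 ≤ k) (hkn : k + 1 ≤ n)
    (x : Fin (k + 1) → EuclideanSpace ℝ (Fin n)) (hx : AffineIndependent ℝ x) :
    (∀ x₀ ∈ KPlaneRadon.admissible x,
      x₀ ∈ KPlaneRadon.sigmaPlane x x₀ ∧
        Module.finrank ℝ (KPlaneRadon.sigmaPlane x x₀).direction = k) ∧
    (∀ f ∈ KPlaneRadon.decayClass n k, ∀ S ∈ KPlaneRadon.planeFamily x,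
      IntegrableOn f (S : Set (EuclideanSpace ℝ (Fin n))) μHE[k]) ∧
    (∀ f ∈ KPlaneRadon.decayClass n k, ∀ g ∈ KPlaneRadon.decayClass n k,
      (∀ S ∈ KPlaneRadon.planeFamily x,
        KPlaneRadon.radonTransform k f S = KPlaneRadon.radonTransform k g S) →
      f = g) := by
  refine ⟨fun p hp => ⟨KPlaneRadon.mem_sigmaPlane_self p,
    KPlaneRadon.finrank_direction_sigmaPlane hx hp⟩, ?_,
    fun f hf g hg hfg => KPlaneRadon.eq_of_radonTransform_eq hkn hx hf hg hfg⟩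
  rintro f hf S ⟨p, hp, rfl⟩
  exact KPlaneRadon.integrableOn_sigmaPlane hx hf hp
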